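/- Let $n,d\ge 1$ be integers, let $A=(a_{ij})$ be an $n\times n$ matrix of independent variables, and let $\mathbb C[A]=\mathbb C[a_{ij}\mid 1\le i,j\le n]$. Let $N=\binom{n-1+d}{d}$ be the number of monomials $x^\alpha$ of degree $d$ in $x=(x_1,\dots,x_n)^{\mathsf T}$, listed in a fixed order. The $d$th symmetric power $\rho_d(A)$ is the $N\times N$ matrix over $\mathbb C[A]$ whose row indexed by $x^\alpha$ consists of the coefficients of the form $(Ax)^\alpha=\prod_i\bigl(\sum_j a_{ij}x_j\bigr)^{\alpha_i}$ with respect to the monomials of degree $d$. Let $\Delta$ and $\Delta_d\in\mathbb C[A]$ be the discriminants of the characteristic polynomials of $A$ and of $\rho_d(A)$, respectively. For a homogeneous polynomial $f\in\mathbb C[x_1,\dots,x_n]$ of degree $d$ with row vector of coefficients $C_f\in\mathbb C^{1\times N}$, let $K_d(f)$ be the $N\times N$ matrix over $\mathbb C[A]$ with rows $C_f,\ C_f\rho_d(A),\ \dots,\ C_f\rho_d(A)^{N-1}$. Define $\Delta_d^{\mathrm{sat}}\in\mathbb C[A]$ as the polynomial of smallest total degree such that $\Delta_d=\Delta_d^{\mathrm{sat}}\cdot\Delta^k$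 for some integer $k\ge 0$; such a polynomial exists and is unique up to a nonzero scalar. Then $\Delta_d^{\mathrm{sat}}$ is a perfect square in $\mathbb C[A]$, and, for every homogeneous $f\in\mathbb C[x_1,\dots,x_n]$ of degree $d$, its square root $\sqrt{\Delta_d^{\mathrm{sat}}}$ divides $\det K_d(f)$. -/

import Mathlib

namespace Kalman

open MvPolynomial

noncomputable section

/-- Exponent vectors of the monomials of degree `d` in `x_1, …, x_n`. -/
abbrev DegMonomial (n d : ℕ) : Type :=
  {α : Fin n →₀ ℕ // α ∈ (Finset.univ : Finset (Fin n)).finsuppAntidiag d}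

/-- The dimension `N` of the space of forms of degree `d` in `n ≥ 1` variables. -/
def formDim (n d : ℕ) : ℕ := (n - 1 + d).choose d

/-- There are exactly `N` monomials of degree `d`, so they can be enumerated by `Fin N`. -/
theorem nonempty_enumeration (n d : ℕ) (hn : 1 ≤ n) :
    Nonempty (Fin (formDim n d) ≃ DegMonomial n d) := by
  refine ⟨(Fintype.equivFinOfCardEq ?_).symm⟩
  rw [Fintype.card_coe, Finset.card_finsuppAntidiag_nat_eq_choose, Finset.card_univ,
    Fintype.card_fin, formDim]
  congr 1
  omega

/-- The substitution `f(x) ↦ f(A x)` on polynomials in `x_1, …, x_n`. -/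
def linSubst {R : Type*} [CommRing R] {n : ℕ} (A : Matrix (Fin n) (Fin n) R) :
    MvPolynomial (Fin n) R →ₐ[R] MvPolynomial (Fin n) R :=
  aeval fun i => ∑ j, C (A i j) * X j

/-- The `d`-th symmetric power `ρ_d(A)`: the row indexed by `α` lists the coefficients of the
form `(A x)^α`. -/
def symPower {R : Type*} [CommRing R] {n : ℕ} (d : ℕ) (A : Matrix (Fin n) (Fin n) R) :
    Matrix (DegMonomial n d) (DegMonomial n d) R :=
  Matrix.of fun α β => coeff β.1 (linSubst A (monomial α.1 1))

/-- The polynomial ring `ℂ[A]` in the entries of an `n × n` matrix. -/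
abbrev MatPoly (n : ℕ) : Type := MvPolynomial (Fin n × Fin n) ℂ

/-- The `n × n` matrix of variables `A = (a_ij)`. -/
abbrev genMat (n : ℕ) : Matrix (Fin n) (Fin n) (MatPoly n) :=
  Matrix.mvPolynomialX (Fin n) (Fin n) ℂ

/-- The row vector `C_f` of coefficients of a form `f` of degree `d`. -/
def coeffRow {n : ℕ} (d : ℕ) (f : MvPolynomial (Fin n) ℂ) : DegMonomial n d → MatPoly n :=
  fun β => C (coeff β.1 f)

/-- The Kalman matrix `K_d(f)` of order `d`: its rows are `C_f, C_f ρ_d(A), …, C_f ρ_d(A)^(N-1)`,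
and its columns are ordered by the enumeration `e` of the monomials of degree `d`. -/
def kalmanMatrix {n d : ℕ} (e : Fin (formDim n d) ≃ DegMonomial n d)
    (f : MvPolynomial (Fin n) ℂ) :
    Matrix (Fin (formDim n d)) (Fin (formDim n d)) (MatPoly n) :=
  Matrix.of fun i j => Matrix.vecMul (coeffRow d f) (symPower d (genMat n) ^ (i : ℕ)) (e j)

/-- `Δ`: the discriminant of the characteristic polynomial of `A`. -/
def matDisc (n : ℕ) : MatPoly n := (genMat n).charpoly.discr

/-- `Δ_d`: the discriminant of the characteristic polynomial of `ρ_d(A)`. -/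
def symDisc (n d : ℕ) : MatPoly n := (symPower d (genMat n)).charpoly.discr

/-- `s` is a `Δ_d^sat`: a polynomial of smallest total degree among those with
`Δ_d = s Δ^k` for some `k ≥ 0`. -/
def IsDiscSat (n d : ℕ) (s : MatPoly n) : Prop :=
  (∃ k : ℕ, symDisc n d = s * matDisc n ^ k) ∧
    ∀ (t : MatPoly n) (k : ℕ), symDisc n d = t * matDisc n ^ k → s.totalDegree ≤ t.totalDegree

end

end Kalman

/-! Substitute `A = S diag(x) S⁻¹` (`conjDiag S`). With `V` and `V_d` the Vandermonde determinants
of the variables and of the monomials of degree `d`, `Δ` becomes `V²` and `Δ_d` becomes `V_d²`.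
Matrices with `Δ ≠ 0` are diagonalizable, so these substitutions jointly determine a polynomial
(`eq_of_forall_conjDiag_eq`), and every symmetric polynomial in `x` lifts to `ℂ[A]`
(`exists_conjDiag_eq_of_isSymmetric`).

Square: let `Δ_d = s Δ^k` with `s` of minimal degree. Then `V_d = q V^k`, and `q²` is symmetric, so
permutations change `q` at most by a sign. If a transposition did negate `q`, then `V ∣ q` and
another factor `Δ` would split off from `s`, against minimality (`IsDiscSat.not_X_sub_X_dvd`). So
`q` is symmetric and lifts to a root of `s`.

Divisibility: `V_d` divides the image of `det K_d(f)` because powers of a diagonal matrix yield a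
Vandermonde factor. The Nullstellensatz carries divisibility back to `ℂ[A]` up to a factor dividing
a power of `Δ`, and coprimality of `q` and `V` makes that factor constant. -/

namespace Kalman

open MvPolynomial

/-! ### Discriminants of monic polynomials. -/

section Discriminant

variable {R S : Type*} [CommRing R] [CommRing S]

theorem discr_eq_resultant_of_monic {f : Polynomial R} (hf : f.Monic) (h0 : 0 < f.natDegree) :
    f.discr = (-1) ^ (f.natDegree * (f.natDegree - 1) / 2) *
      f.resultant f.derivative f.natDegree (f.natDegree - 1) := by
  rw [Polynomial.resultant_deriv (Polynomial.natDegree_pos_iff_degree_pos.mp h0),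
    hf.leadingCoeff, mul_one, ← mul_assoc, ← pow_add, Even.neg_one_pow ⟨_, rfl⟩, one_mul]

/-- Monicity preserves the degree, so both discriminants are resultants of the same formal size. -/
theorem discr_map_of_monic [Nontrivial S] (φ : R →+* S) {f : Polynomial R} (hf : f.Monic)
    (h0 : 0 < f.natDegree) : (f.map φ).discr = φ f.discr := by
  rw [discr_eq_resultant_of_monic (hf.map φ) (by rwa [hf.natDegree_map]),
    discr_eq_resultant_of_monic hf h0, hf.natDegree_map, Polynomial.derivative_map,
    Polynomial.resultant_map_map]
  simp

/-- The resultant with the derivative is the product of all `a i - a j`, `j ≠ i`. The halves `j > i`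
and `j < i` are each the Vandermonde determinant up to sign, and that sign cancels the one in the
discriminant. -/
theorem discr_prod_X_sub_C [Nontrivial R] {m : ℕ} (hm : 0 < m) (a : Fin m → R) :
    (∏ i, (Polynomial.X - Polynomial.C (a i))).discr = (Matrix.vandermonde a).det ^ 2 := by
  have hmon : (∏ i, (Polynomial.X - Polynomial.C (a i))).Monic :=
    Polynomial.monic_prod_of_monic _ _ fun i _ => Polynomial.monic_X_sub_C _
  have hdeg : (∏ i, (Polynomial.X - Polynomial.C (a i))).natDegree = m := by
    rw [Polynomial.natDegree_prod_of_monic _ _ fun i _ => Polynomial.monic_X_sub_C _]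
    simp
  have hder : ∀ i, (Polynomial.derivative
      (∏ i, (Polynomial.X - Polynomial.C (a i)))).eval (a i) =
      ∏ j ∈ Finset.univ.erase i, (a i - a j) := by
    intro i
    rw [Polynomial.derivative_prod_finset, Polynomial.eval_finsetSum,
      Finset.sum_eq_single i]
    · simp [Polynomial.eval_prod]
    · intro b _ hb
      rw [Polynomial.eval_mul, Polynomial.eval_prod, Finset.prod_eq_zero (i := i)]
      · simp
      · simp [hb.symm]
      · simp
    · simp
  have hd : (Polynomial.derivative (∏ i, (Polynomial.X - Polynomial.C (a i)))).natDegree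
      ≤ m - 1 := by
    have := Polynomial.natDegree_derivative_le (∏ i, (Polynomial.X - Polynomial.C (a i)))
    rwa [hdeg] at this
  have hres := Polynomial.resultant_prod_left Finset.univ
    (fun i => Polynomial.X - Polynomial.C (a i))
    (Polynomial.derivative (∏ i, (Polynomial.X - Polynomial.C (a i)))) (m - 1)
    (by simp) hd
  simp only [Polynomial.natDegree_X_sub_C, Polynomial.resultant_X_sub_C_left _ _ _ hd,
    hder] at hres
  rw [hdeg] at hres
  rw [discr_eq_resultant_of_monic hmon (by omega), hdeg, hres]
  have hcard : ∑ i : Fin m, (Finset.Ioi i).card = m * (m - 1) / 2 := by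
    simp only [Fin.card_Ioi]
    rw [Fin.sum_univ_eq_sum_range (fun i => m - 1 - i), Finset.sum_range_reflect (fun i => i),
      Finset.sum_range_id]
  have hneg : ∏ i : Fin m, ∏ j ∈ Finset.Ioi i, (a i - a j) =
      (-1) ^ (m * (m - 1) / 2) * (Matrix.vandermonde a).det := by
    rw [Matrix.det_vandermonde, ← hcard, ← Finset.prod_pow_eq_pow_sum, ← Finset.prod_mul_distrib]
    refine Finset.prod_congr rfl fun i _ => ?_
    rw [← Finset.prod_const, ← Finset.prod_mul_distrib]
    exact Finset.prod_congr rfl fun j _ => by ring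
  have hpos : ∏ i : Fin m, ∏ j ∈ Finset.Iio i, (a i - a j) = (Matrix.vandermonde a).det := by
    rw [Matrix.det_vandermonde]
    exact Finset.prod_comm' (by simp)
  have hsplit : ∀ i : Fin m, ∏ j ∈ Finset.univ.erase i, (a i - a j) =
      (∏ j ∈ Finset.Ioi i, (a i - a j)) * ∏ j ∈ Finset.Iio i, (a i - a j) := by
    intro i
    rw [← Finset.prod_union]
    · congr 1
      ext j
      simp [lt_or_lt_iff_ne, eq_comm]
    · exact Finset.disjoint_left.mpr fun j h1 h2 => by
        simp only [Finset.mem_Ioi, Finset.mem_Iio] at h1 h2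
        exact lt_asymm h1 h2
  simp only [hsplit, Finset.prod_mul_distrib, hneg, hpos]
  rw [mul_assoc, ← mul_assoc, ← pow_add, Even.neg_one_pow ⟨_, rfl⟩, one_mul, sq]

end Discriminant

/-! ### Multiplicativity of the symmetric power and its value on diagonal matrices. -/

section SymPower

variable {R S : Type*} [CommRing R] [CommRing S] {n d : ℕ}

theorem sum_degMonomial_of_isHomogeneous {g : MvPolynomial (Fin n) R} (hg : g.IsHomogeneous d) :
    g = ∑ γ : DegMonomial n d, coeff γ.1 g • monomial γ.1 1 := by
  classical
  ext β
  rw [coeff_sum]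
  by_cases hβ : β ∈ (Finset.univ : Finset (Fin n)).finsuppAntidiag d
  · rw [Finset.sum_eq_single (⟨β, hβ⟩ : DegMonomial n d)]
    · simp
    · intro b _ hb
      have : b.1 ≠ β := fun h => hb (Subtype.ext h)
      simp [coeff_monomial, this]
    · simp
  · rw [Finset.sum_eq_zero, hg.coeff_eq_zero]
    · intro h
      apply hβ
      simpa [Finset.mem_finsuppAntidiag, Finsupp.degree_eq_sum] using h
    · intro b _
      have : b.1 ≠ β := fun h => hβ (h ▸ b.2)
      simp [coeff_monomial, this]

theorem linSubst_mul (A B : Matrix (Fin n) (Fin n) R) :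
    linSubst (A * B) = (linSubst B).comp (linSubst A) := by
  apply algHom_ext
  intro i
  simp only [linSubst, aeval_X, AlgHom.comp_apply, map_sum, map_mul, Matrix.mul_apply,
    MvPolynomial.algHom_C, algebraMap_eq, Finset.sum_mul, Finset.mul_sum]
  rw [Finset.sum_comm]
  simp [mul_assoc]

theorem isHomogeneous_linSubst_monomial (A : Matrix (Fin n) (Fin n) R) (α : DegMonomial n d) :
    (linSubst A (monomial α.1 1)).IsHomogeneous d := by
  rw [linSubst, aeval_monomial, map_one, one_mul]
  have hα : ∑ i, α.1 i = d := (Finset.mem_finsuppAntidiag.mp α.2).1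
  have h : ∀ i, (∑ j, C (A i j) * X j : MvPolynomial (Fin n) R).IsHomogeneous 1 := fun i =>
    IsHomogeneous.sum _ _ _ fun j _ => by
      simpa using (isHomogeneous_C (Fin n) (A i j)).mul (isHomogeneous_X R j)
  have h2 := IsHomogeneous.prod Finset.univ
    (fun i => (∑ j, C (A i j) * X j : MvPolynomial (Fin n) R) ^ α.1 i) (fun i => α.1 i)
    fun i _ => by simpa using (h i).pow (α.1 i)
  rw [hα] at h2
  rwa [Finsupp.prod_fintype _ _ (by simp)]

/-- Substitution reverses products, but coefficients are stored in rows, so the order is restored: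
expand `(A x)^α` in monomials, then substitute `B x`. -/
theorem symPower_mul (A B : Matrix (Fin n) (Fin n) R) :
    symPower d (A * B) = symPower d A * symPower d B := by
  ext α β
  simp only [symPower, Matrix.of_apply, Matrix.mul_apply, linSubst_mul, AlgHom.comp_apply]
  conv_lhs => rw [sum_degMonomial_of_isHomogeneous (isHomogeneous_linSubst_monomial A α)]
  simp [map_sum, coeff_sum]

theorem linSubst_diagonal_monomial (v : Fin n → R) (α : Fin n →₀ ℕ) :
    linSubst (Matrix.diagonal v) (monomial α 1) = monomial α (∏ i, v i ^ α i) := by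
  rw [linSubst, aeval_monomial, map_one, one_mul, Finsupp.prod_fintype _ _ (by simp),
    monomial_eq, Finsupp.prod_fintype _ _ (by simp), map_prod, ← Finset.prod_mul_distrib]
  refine Finset.prod_congr rfl fun i _ => ?_
  rw [Finset.sum_eq_single i (by intro j _ hj; simp [Matrix.diagonal_apply_ne _ hj.symm])
    (by simp)]
  simp [mul_pow]

theorem symPower_diagonal (v : Fin n → R) :
    symPower d (Matrix.diagonal v) = Matrix.diagonal fun α => ∏ i, v i ^ α.1 i := by
  classical
  ext α β
  simp only [symPower, Matrix.of_apply, linSubst_diagonal_monomial, coeff_monomial,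
    Matrix.diagonal_apply, Subtype.ext_iff]

theorem symPower_one : symPower d (1 : Matrix (Fin n) (Fin n) R) = 1 := by
  rw [← Matrix.diagonal_one, symPower_diagonal]
  simp

theorem symPower_map (φ : R →+* S) (A : Matrix (Fin n) (Fin n) R) :
    symPower d (A.map φ) = (symPower d A).map φ := by
  ext α β
  simp only [symPower, Matrix.of_apply, Matrix.map_apply, ← coeff_map]
  congr 1
  rw [linSubst, linSubst, aeval_monomial, aeval_monomial, Finsupp.prod_fintype _ _ (by simp),
    Finsupp.prod_fintype _ _ (by simp)]
  simp [map_prod, map_sum]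

end SymPower

end Kalman

namespace Kalman

open MvPolynomial

/-! ### Restriction to diagonalized matrices, and lifting from symmetric polynomials. -/

noncomputable section Conj

variable {n d : ℕ}

/-- The substitution `A ↦ S diag(x_1, …, x_n) S⁻¹` on polynomials in the entries of `A`. -/
def conjDiag (S : (Matrix (Fin n) (Fin n) ℂ)ˣ) : MatPoly n →ₐ[ℂ] MvPolynomial (Fin n) ℂ :=
  aeval fun p => (S.1.map C * Matrix.diagonal X * (S⁻¹).1.map C :
    Matrix (Fin n) (Fin n) (MvPolynomial (Fin n) ℂ)) p.1 p.2

theorem genMat_map_conjDiag (S : (Matrix (Fin n) (Fin n) ℂ)ˣ) :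
    (genMat n).map (conjDiag S : MatPoly n →+* MvPolynomial (Fin n) ℂ) =
      S.1.map C * Matrix.diagonal X * (S⁻¹).1.map C := by
  ext i j
  simp [conjDiag, Matrix.mvPolynomialX]

theorem map_C_inv_mul (S : (Matrix (Fin n) (Fin n) ℂ)ˣ) :
    (S⁻¹).1.map C * S.1.map (C : ℂ →+* MvPolynomial (Fin n) ℂ) = 1 := by
  rw [← Matrix.map_mul, Units.inv_mul, Matrix.map_one _ (map_zero _) (map_one _)]

theorem charpoly_conj {R ι : Type*} [CommRing R] [Fintype ι] [DecidableEq ι]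
    {U D W : Matrix ι ι R} (h : W * U = 1) : (U * D * W).charpoly = D.charpoly := by
  rw [Matrix.charpoly_mul_comm, ← mul_assoc, h, one_mul]

theorem symPower_map_conjDiag (S : (Matrix (Fin n) (Fin n) ℂ)ˣ) :
    (symPower d (genMat n)).map (conjDiag S : MatPoly n →+* MvPolynomial (Fin n) ℂ) =
      symPower d (S.1.map C) * Matrix.diagonal (fun α => monomial α.1 1) *
        symPower d ((S⁻¹).1.map C) := by
  rw [← symPower_map, genMat_map_conjDiag, symPower_mul, symPower_mul, symPower_diagonal]
  congr 3
  ext1 α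
  rw [monomial_eq, Finsupp.prod_fintype _ _ (by simp), map_one, one_mul]

theorem symPower_map_C_inv_mul (S : (Matrix (Fin n) (Fin n) ℂ)ˣ) :
    symPower d ((S⁻¹).1.map C) * symPower d (S.1.map (C : ℂ →+* MvPolynomial (Fin n) ℂ)) = 1 := by
  rw [← symPower_mul, map_C_inv_mul, symPower_one]

theorem card_degMonomial (hn : 1 ≤ n) : Fintype.card (DegMonomial n d) = formDim n d := by
  obtain ⟨e⟩ := nonempty_enumeration n d hn
  simpa using (Fintype.card_congr e).symm

theorem formDim_pos : 0 < formDim n d :=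
  Nat.choose_pos (by omega)

/-- The Vandermonde determinant of the variables. -/
def vandX (n : ℕ) : MvPolynomial (Fin n) ℂ := (Matrix.vandermonde X).det

/-- The Vandermonde determinant of the monomials of degree `d`. -/
def vandMon (e : Fin (formDim n d) ≃ DegMonomial n d) : MvPolynomial (Fin n) ℂ :=
  (Matrix.vandermonde fun i => monomial (e i).1 1).det

theorem charpoly_map_conjDiag (S : (Matrix (Fin n) (Fin n) ℂ)ˣ) :
    (genMat n).charpoly.map (conjDiag S : MatPoly n →+* MvPolynomial (Fin n) ℂ) =
      ∏ i, (Polynomial.X - Polynomial.C (X i)) := by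
  rw [← Matrix.charpoly_map, genMat_map_conjDiag, charpoly_conj (map_C_inv_mul S),
    Matrix.charpoly_diagonal]

theorem conjDiag_matDisc (hn : 1 ≤ n) (S : (Matrix (Fin n) (Fin n) ℂ)ˣ) :
    conjDiag S (matDisc n) = vandX n ^ 2 := by
  have h := discr_map_of_monic (conjDiag S : MatPoly n →+* MvPolynomial (Fin n) ℂ)
    (Matrix.charpoly_monic (genMat n)) (by rw [Matrix.charpoly_natDegree_eq_dim]; simpa)
  rw [charpoly_map_conjDiag, discr_prod_X_sub_C hn] at h
  exact h.symm

theorem conjDiag_symDisc (hn : 1 ≤ n) (S : (Matrix (Fin n) (Fin n) ℂ)ˣ)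
    (e : Fin (formDim n d) ≃ DegMonomial n d) :
    conjDiag S (symDisc n d) = vandMon e ^ 2 := by
  have h := discr_map_of_monic (conjDiag S : MatPoly n →+* MvPolynomial (Fin n) ℂ)
    (Matrix.charpoly_monic (symPower d (genMat n)))
    (by rw [Matrix.charpoly_natDegree_eq_dim, card_degMonomial hn]; exact formDim_pos)
  rw [← Matrix.charpoly_map, symPower_map_conjDiag, charpoly_conj (symPower_map_C_inv_mul S),
    Matrix.charpoly_diagonal, ← Equiv.prod_comp e, discr_prod_X_sub_C (formDim_pos)] at h
  rw [symDisc, vandMon, h, RingHom.coe_coe]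

theorem vandX_ne_zero : vandX n ≠ 0 :=
  Matrix.det_vandermonde_ne_zero_iff.mpr (X_injective (R := ℂ))

theorem vandMon_ne_zero (e : Fin (formDim n d) ≃ DegMonomial n d) : vandMon e ≠ 0 :=
  Matrix.det_vandermonde_ne_zero_iff.mpr fun _ _ h =>
    e.injective (Subtype.ext (monomial_left_injective one_ne_zero h))

theorem matDisc_ne_zero (hn : 1 ≤ n) : matDisc n ≠ 0 := fun h => by
  have := conjDiag_matDisc hn 1
  rw [h, map_zero] at this
  exact pow_ne_zero 2 vandX_ne_zero this.symm

theorem symDisc_ne_zero (hn : 1 ≤ n) : symDisc n d ≠ 0 := fun h => by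
  obtain ⟨e⟩ := nonempty_enumeration n d hn
  have := conjDiag_symDisc hn 1 e
  rw [h, map_zero] at this
  exact pow_ne_zero 2 (vandMon_ne_zero e) this.symm

theorem exists_fin_map_eq {α : Type*} {s : Multiset α} {m : ℕ} (h : s.card = m) :
    ∃ μ : Fin m → α, s = Finset.univ.val.map μ := by
  subst h
  induction s using Quot.inductionOn with
  | h l => exact ⟨l.get, (congrArg _ (List.ofFn_get l).symm).trans (Fin.univ_val_map l.get).symm⟩

/-- A nonzero discriminant forces distinct eigenvalues, hence independent eigenvectors; these are
the columns of `S`. -/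
theorem exists_diagonalization {A : Matrix (Fin n) (Fin n) ℂ} (hn : 1 ≤ n)
    (h : A.charpoly.discr ≠ 0) :
    ∃ (S : (Matrix (Fin n) (Fin n) ℂ)ˣ) (μ : Fin n → ℂ),
      A = S.1 * Matrix.diagonal μ * (S⁻¹).1 := by
  obtain ⟨μ, hμ⟩ : ∃ μ : Fin n → ℂ, A.charpoly = ∏ i, (Polynomial.X - Polynomial.C (μ i)) := by
    have hs := IsAlgClosed.splits A.charpoly
    obtain ⟨μ, hμ⟩ := exists_fin_map_eq (s := A.charpoly.roots) (m := n) (by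
      rw [← hs.natDegree_eq_card_roots, Matrix.charpoly_natDegree_eq_dim, Fintype.card_fin])
    refine ⟨μ, ?_⟩
    have h1 := hs.eq_prod_roots_of_monic A.charpoly_monic
    rwa [hμ, Multiset.map_map] at h1
  rw [hμ, discr_prod_X_sub_C hn] at h
  have hinj : Function.Injective μ :=
    Matrix.det_vandermonde_ne_zero_iff.mp (ne_zero_pow two_ne_zero h)
  have hev : ∀ i, ∃ v, Module.End.HasEigenvector (Matrix.toLin' A) (μ i) v := by
    intro i
    apply Module.End.HasEigenvalue.exists_hasEigenvector
    rw [Module.End.hasEigenvalue_iff_isRoot_charpoly, Matrix.charpoly_toLin', hμ,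
      Polynomial.IsRoot, Polynomial.eval_prod]
    exact Finset.prod_eq_zero (Finset.mem_univ i) (by simp)
  choose v hv using hev
  have hli := Module.End.eigenvectors_linearIndependent' _ μ hinj v hv
  have hu : IsUnit (Matrix.of v).transpose := by
    rw [Matrix.isUnit_transpose]
    exact Matrix.linearIndependent_rows_iff_isUnit.mp hli
  refine ⟨hu.unit, μ, ?_⟩
  rw [Units.eq_mul_inv_iff_mul_eq, IsUnit.unit_spec]
  ext i j
  have := congrFun (hv j).apply_eq_smul i
  rw [Matrix.mul_diagonal]
  simpa [Matrix.toLin'_apply, Matrix.mulVec, dotProduct, Matrix.mul_apply, mul_comm] using this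

theorem eval_conjDiag (S : (Matrix (Fin n) (Fin n) ℂ)ˣ) (μ : Fin n → ℂ) (p : MatPoly n) :
    eval μ (conjDiag S p) =
      eval (fun q => (S.1 * Matrix.diagonal μ * (S⁻¹).1) q.1 q.2) p := by
  have : (aeval μ : _ →ₐ[ℂ] ℂ).comp (conjDiag S) =
      aeval (fun q => (S.1 * Matrix.diagonal μ * (S⁻¹).1) q.1 q.2) := by
    apply algHom_ext
    intro q
    simp [conjDiag, Matrix.mul_apply, Matrix.diagonal_apply, map_sum]
  simpa [coe_aeval_eq_eval] using DFunLike.congr_fun this p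

theorem eval_matDisc (hn : 1 ≤ n) (a : Fin n × Fin n → ℂ) :
    eval a (matDisc n) = (Matrix.of fun i j => a (i, j)).charpoly.discr := by
  rw [matDisc, ← discr_map_of_monic (eval a) (Matrix.charpoly_monic (genMat n))
    (by rw [Matrix.charpoly_natDegree_eq_dim]; simpa), ← Matrix.charpoly_map]
  congr 2
  ext i j
  simp [Matrix.mvPolynomialX]

theorem exists_conjDiag_of_eval_matDisc_ne_zero (hn : 1 ≤ n) {a : Fin n × Fin n → ℂ}
    (h : eval a (matDisc n) ≠ 0) :
    ∃ (S : (Matrix (Fin n) (Fin n) ℂ)ˣ) (μ : Fin n → ℂ),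
      ∀ p : MatPoly n, eval a p = eval μ (conjDiag S p) := by
  rw [eval_matDisc hn] at h
  obtain ⟨S, μ, hA⟩ := exists_diagonalization hn h
  refine ⟨S, μ, fun p => ?_⟩
  rw [eval_conjDiag, ← hA]
  rfl

/-- After multiplication by `Δ` the two sides agree at every matrix: trivially where `Δ = 0`, by
diagonalization elsewhere. -/
theorem eq_of_forall_conjDiag_eq (hn : 1 ≤ n) {p q : MatPoly n}
    (h : ∀ S, conjDiag S p = conjDiag S q) : p = q := by
  apply mul_left_cancel₀ (matDisc_ne_zero hn)
  apply MvPolynomial.funext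
  intro a
  rw [map_mul, map_mul]
  by_cases ha : eval a (matDisc n) = 0
  · rw [ha, zero_mul, zero_mul]
  · obtain ⟨S, μ, hS⟩ := exists_conjDiag_of_eval_matDisc_ne_zero hn ha
    rw [hS p, hS q, h S]

theorem exists_conjDiag_eq_of_isSymmetric {p : MvPolynomial (Fin n) ℂ} (hp : p.IsSymmetric) :
    ∃ q : MatPoly n, ∀ S, conjDiag S q = p := by
  obtain ⟨g, hg⟩ := esymmAlgHom_surjective ℂ (Fintype.card_fin n).le ⟨p, hp⟩
  -- Index `i` stands for the elementary symmetric polynomial of degree `i + 1`, which is a signed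
  -- coefficient of the characteristic polynomial.
  refine ⟨aeval (fun i : Fin n => (-1) ^ (i.1 + 1) * (genMat n).charpoly.coeff (n - (i + 1))) g,
    fun S => ?_⟩
  have h2 : p = (((symmetricSubalgebra (Fin n) ℂ).val).comp (esymmAlgHom (Fin n) ℂ n)) g := by
    simp [hg]
  rw [h2, ← AlgHom.comp_apply]
  congr 1
  apply algHom_ext
  intro i
  have hc : conjDiag S ((genMat n).charpoly.coeff (n - (i + 1))) =
      (∏ i, (Polynomial.X - Polynomial.C (X i : MvPolynomial (Fin n) ℂ))).coeff
        (n - (i + 1)) := by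
    rw [← charpoly_map_conjDiag S, Polynomial.coeff_map]
    rfl
  have hv := Multiset.prod_X_sub_C_coeff
    (Finset.univ.val.map (X : Fin n → MvPolynomial (Fin n) ℂ)) (k := n - (i + 1)) (by simp)
  rw [Multiset.map_map] at hv
  have hk : n - (n - (i.1 + 1)) = i.1 + 1 := by omega
  simp only [Multiset.card_map, Finset.card_val, Finset.card_univ, Fintype.card_fin, hk] at hv
  simp only [AlgHom.comp_apply, aeval_X, map_mul, map_pow, map_neg, map_one, hc, esymmAlgHom]
  erw [hv]
  rw [← mul_assoc, ← pow_add, Even.neg_one_pow ⟨_, rfl⟩, one_mul]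
  exact congrFun (esymm_eq_multiset_esymm (Fin n) ℂ).symm _

/-- Conjugation by a permutation matrix permutes the diagonal. Hence an image that does not depend
on `S` is symmetric. -/
theorem exists_conjDiag_eq_rename (σ : Equiv.Perm (Fin n)) :
    ∃ S, ∀ p : MatPoly n, rename σ (conjDiag 1 p) = conjDiag S p := by
  let U : (Matrix (Fin n) (Fin n) ℂ)ˣ :=
    ⟨σ.permMatrix ℂ, (σ⁻¹).permMatrix ℂ, by
      rw [← Matrix.permMatrix_mul]; simp, by rw [← Matrix.permMatrix_mul]; simp⟩
  refine ⟨U, fun p => ?_⟩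
  have : (rename σ).comp (conjDiag 1) = conjDiag U := by
    apply algHom_ext
    rintro ⟨i, j⟩
    have h1 : ∀ τ : Equiv.Perm (Fin n),
        (τ.permMatrix ℂ).map (C : ℂ →+* MvPolynomial (Fin n) ℂ) = τ.permMatrix _ := by
      intro τ
      ext1 i j
      simp [Equiv.Perm.permMatrix, PEquiv.toMatrix_apply, apply_ite]
    have h2 : U.1.map (C : ℂ →+* MvPolynomial (Fin n) ℂ) * Matrix.diagonal X *
        (U⁻¹).1.map C = Matrix.diagonal fun i => X (σ i) := by
      change (σ.permMatrix ℂ).map _ * _ * (σ⁻¹.permMatrix ℂ).map _ = _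
      rw [h1, h1, Equiv.Perm.permMatrix, PEquiv.toMatrix_toPEquiv_mul, Equiv.Perm.permMatrix,
        PEquiv.mul_toMatrix_toPEquiv]
      ext1 i j
      have : (Equiv.symm σ⁻¹) j = σ j := rfl
      simp [Matrix.diagonal_apply, this]
    simp only [AlgHom.comp_apply, conjDiag, aeval_X, h2]
    rw [inv_one, Units.val_one, Matrix.map_one _ (map_zero _) (map_one _), one_mul, mul_one]
    by_cases h : i = j
    · simp [h]
    · simp [h]
  exact DFunLike.congr_fun this p

end Conj

end Kalman

namespace Kalman

open MvPolynomial

/-! ### Divisibility by differences of variables. -/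

section Differences

variable {n : ℕ}

theorem dvd_algHom_sub_algHom {R σ B : Type*} [CommRing R] [CommRing B] [Algebra R B]
    {f g : MvPolynomial σ R →ₐ[R] B} {a : B} (h : ∀ i, a ∣ f (X i) - g (X i))
    (p : MvPolynomial σ R) : a ∣ f p - g p := by
  have : (Ideal.Quotient.mkₐ R (Ideal.span {a})).comp f =
      (Ideal.Quotient.mkₐ R (Ideal.span {a})).comp g := by
    apply algHom_ext
    intro i
    simpa [Ideal.Quotient.eq, Ideal.mem_span_singleton] using h i
  simpa [Ideal.Quotient.eq, Ideal.mem_span_singleton] using DFunLike.congr_fun this p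

theorem X_sub_X_dvd_iff {i j : Fin n} {p : MvPolynomial (Fin n) ℂ} :
    X i - X j ∣ p ↔ rename (Function.update id i j) p = 0 := by
  constructor
  · rintro ⟨q, rfl⟩
    rcases eq_or_ne i j with rfl | h
    · simp
    · simp [Function.update_of_ne h.symm]
  · intro h
    have h2 := dvd_algHom_sub_algHom (a := X i - X j)
      (f := AlgHom.id ℂ (MvPolynomial (Fin n) ℂ)) (g := rename (Function.update id i j))
      (fun k => by
        rcases eq_or_ne k i with rfl | hk
        · simp
        · simp [Function.update_of_ne hk]) p
    simpa [h] using h2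

theorem X_sub_X_dvd_X_sub_X_iff {i j k l : Fin n} :
    (X i - X j : MvPolynomial (Fin n) ℂ) ∣ X k - X l ↔
      Function.update id i j k = Function.update id i j l := by
  rw [X_sub_X_dvd_iff, map_sub, rename_X, rename_X, sub_eq_zero, (X_injective).eq_iff]

theorem prime_X_sub_X {i j : Fin n} (h : i ≠ j) :
    Prime (X i - X j : MvPolynomial (Fin n) ℂ) := by
  refine ⟨sub_ne_zero.mpr ((X_injective (R := ℂ)).ne h), fun hu => ?_, fun p q hpq => ?_⟩
  · have := X_sub_X_dvd_iff.mp (hu.dvd (a := 1))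
    simp at this
  · simpa [X_sub_X_dvd_iff] using hpq

theorem vandX_eq_prod : vandX n =
    ∏ x ∈ (Finset.univ : Finset (Fin n)).sigma fun i => Finset.Ioi i, (X x.2 - X x.1) := by
  rw [vandX, Matrix.det_vandermonde, Finset.prod_sigma']

/-- The factors of the Vandermonde product are pairwise non-associated primes. -/
theorem vandX_dvd {p : MvPolynomial (Fin n) ℂ} (h : ∀ i j, i ≠ j → X i - X j ∣ p) :
    vandX n ∣ p := by
  rw [vandX_eq_prod]
  apply Finset.prod_dvd_of_isRelPrime
  · rintro ⟨i, j⟩ hij ⟨k, l⟩ hkl hne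
    simp only [Finset.coe_sigma, Set.mem_sigma_iff, Finset.coe_Ioi, Set.mem_Ioi] at hij hkl
    have hji : j ≠ i := hij.2.ne'
    refine ((prime_X_sub_X hji).irreducible.isRelPrime_iff_not_dvd).mpr fun hd => hne ?_
    rw [X_sub_X_dvd_X_sub_X_iff] at hd
    have := hij.2
    have := hkl.2
    simp only [Function.update_apply, id] at hd
    split_ifs at hd <;> grind
  · rintro ⟨i, j⟩ hij
    simp only [Finset.mem_sigma, Finset.mem_Ioi] at hij
    exact h _ _ hij.2.ne'

theorem isRelPrime_vandX {p : MvPolynomial (Fin n) ℂ} (h : ∀ i j, i ≠ j → ¬ X i - X j ∣ p) :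
    IsRelPrime p (vandX n) := by
  rw [vandX_eq_prod]
  apply IsRelPrime.prod_right
  rintro ⟨i, j⟩ hij
  simp only [Finset.mem_sigma, Finset.mem_Ioi] at hij
  exact (((prime_X_sub_X hij.2.ne').irreducible.isRelPrime_iff_not_dvd).mpr
    (h _ _ hij.2.ne')).symm

/-- Modulo `X i - X j` the swap acts trivially, so `p ≡ -p`, and 2 is invertible. -/
theorem X_sub_X_dvd_of_rename_swap {i j : Fin n} {p : MvPolynomial (Fin n) ℂ}
    (h : rename (Equiv.swap i j) p = -p) : X i - X j ∣ p := by
  have h2 := dvd_algHom_sub_algHom (a := X i - X j)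
    (f := AlgHom.id ℂ (MvPolynomial (Fin n) ℂ)) (g := rename (Equiv.swap i j))
    (fun k => by
      rcases eq_or_ne k i with rfl | hi
      · simp
      rcases eq_or_ne k j with rfl | hj
      · simpa using (dvd_neg.mpr dvd_rfl : X i - X k ∣ -(X i - X k : MvPolynomial (Fin n) ℂ))
      · simp [Equiv.swap_apply_of_ne_of_ne hi hj]) p
  rw [h, AlgHom.id_apply, sub_neg_eq_add, ← two_mul] at h2
  have h3 := h2.mul_left (C (1 / 2))
  rw [← mul_assoc, ← map_ofNat (C : ℂ →+* MvPolynomial (Fin n) ℂ) 2, ← C_mul] at h3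
  simpa using h3

theorem isSymmetric_of_rename_swap {p : MvPolynomial (Fin n) ℂ}
    (h : ∀ i j, i ≠ j → rename (Equiv.swap i j) p = p) : p.IsSymmetric := by
  intro σ
  induction σ using Equiv.Perm.swap_induction_on with
  | one => simp
  | swap_mul τ i j hij hτ =>
    rw [Equiv.Perm.coe_mul, ← rename_rename, hτ, h i j hij]

end Differences

/-! ### The saturated discriminant: uniqueness, square root, divisibility. -/

section Saturation

variable {n d : ℕ}

theorem isSymmetric_conjDiag_of_forall_eq {p : MatPoly n}
    (h : ∀ S, conjDiag S p = conjDiag 1 p) : (conjDiag 1 p).IsSymmetric := fun σ => by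
  obtain ⟨S, hS⟩ := exists_conjDiag_eq_rename σ
  rw [hS, h]

theorem isSymmetric_vandX_sq (hn : 1 ≤ n) : (vandX n ^ 2).IsSymmetric := by
  rw [← conjDiag_matDisc hn 1]
  exact isSymmetric_conjDiag_of_forall_eq fun S => by simp only [conjDiag_matDisc hn]

theorem isSymmetric_vandMon_sq (hn : 1 ≤ n) (e : Fin (formDim n d) ≃ DegMonomial n d) :
    (vandMon e ^ 2).IsSymmetric := by
  rw [← conjDiag_symDisc hn 1 e]
  exact isSymmetric_conjDiag_of_forall_eq fun S => by simp only [conjDiag_symDisc hn _ e]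

theorem isSymmetric_of_mul_right {p q : MvPolynomial (Fin n) ℂ} (hq : q.IsSymmetric)
    (hq0 : q ≠ 0) (hpq : (p * q).IsSymmetric) : p.IsSymmetric := fun σ => by
  have h := hpq σ
  rw [map_mul, hq σ] at h
  exact mul_right_cancel₀ hq0 h

theorem rename_eq_or_eq_neg {p : MvPolynomial (Fin n) ℂ} (h : (p ^ 2).IsSymmetric)
    (σ : Equiv.Perm (Fin n)) : rename σ p = p ∨ rename σ p = -p := by
  rw [← sq_eq_sq_iff_eq_or_eq_neg, ← map_pow, h σ]

/-- Permutations act transitively on ordered pairs of distinct indices and change `p` at most by a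
sign. -/
theorem X_sub_X_dvd_of_isSymmetric_sq {p : MvPolynomial (Fin n) ℂ} (h : (p ^ 2).IsSymmetric)
    {i j : Fin n} (hij : i ≠ j) (hd : X i - X j ∣ p) {k l : Fin n} (hkl : k ≠ l) :
    X k - X l ∣ p := by
  obtain ⟨σ, rfl, rfl⟩ : ∃ σ : Equiv.Perm (Fin n), σ i = k ∧ σ j = l := by
    -- The second swap corrects the image of `j` and fixes `k`, since `k` is neither that image nor
    -- `l`.
    refine ⟨(Equiv.swap i k).trans (Equiv.swap (Equiv.swap i k j) l), ?_, ?_⟩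
    · simp only [Equiv.trans_apply, Equiv.swap_apply_left]
      apply Equiv.swap_apply_of_ne_of_ne _ hkl
      intro h
      apply hij
      have := congrArg (Equiv.swap i k) h
      simpa using this
    · simp
  have h2 : rename σ (X i - X j) ∣ rename σ p := map_dvd _ hd
  rw [map_sub, rename_X, rename_X] at h2
  rcases rename_eq_or_eq_neg h σ with h3 | h3
  · rwa [h3] at h2
  · rwa [h3, dvd_neg] at h2

theorem exists_C_eq_of_totalDegree_le {σ : Type*} {s t u : MvPolynomial σ ℂ} (hs : s ≠ 0)
    (h : s = t * u) (hd : s.totalDegree ≤ t.totalDegree) : ∃ c : ℂ, c ≠ 0 ∧ u = C c := by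
  subst h
  rw [mul_ne_zero_iff] at hs
  rw [totalDegree_mul_of_isDomain hs.1 hs.2] at hd
  have hu := (totalDegree_eq_zero_iff_eq_C (p := u)).mp (by omega)
  refine ⟨_, fun h0 => hs.2 ?_, hu⟩
  rw [hu, h0, C_0]

theorem IsDiscSat.ne_zero (hn : 1 ≤ n) {s : MatPoly n} (hs : IsDiscSat n d s) : s ≠ 0 := by
  rintro rfl
  obtain ⟨k, hk⟩ := hs.1
  exact symDisc_ne_zero hn (by rw [hk, zero_mul])

theorem exists_isDiscSat : ∃ s : MatPoly n, IsDiscSat n d s := by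
  classical
  have hne : ∃ m, ∃ (s : MatPoly n) (k : ℕ),
      symDisc n d = s * matDisc n ^ k ∧ s.totalDegree = m :=
    ⟨_, symDisc n d, 0, by simp, rfl⟩
  obtain ⟨s, k, hk, hm⟩ := Nat.find_spec hne
  exact ⟨s, ⟨k, hk⟩, fun t l hl => hm ▸ Nat.find_min' hne ⟨t, l, hl, rfl⟩⟩

theorem isDiscSat_unique (hn : 1 ≤ n) {s t : MatPoly n} (hs : IsDiscSat n d s)
    (ht : IsDiscSat n d t) : ∃ c : ℂ, c ≠ 0 ∧ t = C c * s := by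
  obtain ⟨k, hk⟩ := hs.1
  obtain ⟨l, hl⟩ := ht.1
  have h0 : ∀ m, matDisc n ^ m ≠ 0 := fun m => pow_ne_zero m (matDisc_ne_zero hn)
  have heq := hk.symm.trans hl
  rcases le_total k l with hkl | hkl
  · obtain ⟨m, rfl⟩ := Nat.exists_eq_add_of_le hkl
    have h1 : s = t * matDisc n ^ m := by
      apply mul_right_cancel₀ (h0 k)
      rw [heq]; ring
    obtain ⟨c, hc, hu⟩ := exists_C_eq_of_totalDegree_le (hs.ne_zero hn) h1 (hs.2 _ _ hl)
    refine ⟨c⁻¹, inv_ne_zero hc, ?_⟩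
    rw [h1, hu, mul_left_comm, ← C_mul, inv_mul_cancel₀ hc, C_1, mul_one]
  · obtain ⟨m, rfl⟩ := Nat.exists_eq_add_of_le hkl
    have h1 : t = s * matDisc n ^ m := by
      apply mul_right_cancel₀ (h0 l)
      rw [← heq]; ring
    obtain ⟨c, hc, hu⟩ := exists_C_eq_of_totalDegree_le (ht.ne_zero hn) h1 (ht.2 _ _ hk)
    exact ⟨c, hc, by rw [h1, hu, mul_comm]⟩

theorem eval_zero_vandX {i j : Fin n} (h : i ≠ j) : eval 0 (vandX n) = 0 := by
  have h1 : (eval 0).mapMatrix (Matrix.vandermonde (X : Fin n → MvPolynomial (Fin n) ℂ)) =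
      Matrix.vandermonde (0 : Fin n → ℂ) := by
    ext a b
    simp [Matrix.vandermonde_apply]
  rw [vandX, RingHom.map_det, h1]
  exact Matrix.det_vandermonde_eq_zero_iff.mpr ⟨i, j, rfl, h⟩

/-- One such factor would give `q = V u` with `u²` symmetric; lifting `u²` to `t` gives `s = t Δ`,
and minimality makes `Δ` constant. -/
theorem IsDiscSat.not_X_sub_X_dvd (hn : 1 ≤ n) {s : MatPoly n} (hs : IsDiscSat n d s) {k : ℕ}
    (hk : symDisc n d = s * matDisc n ^ k) (e : Fin (formDim n d) ≃ DegMonomial n d)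
    {q : MvPolynomial (Fin n) ℂ} (hq : q ^ 2 * (vandX n ^ 2) ^ k = vandMon e ^ 2)
    (hsym : (q ^ 2).IsSymmetric) {i j : Fin n} (hij : i ≠ j) : ¬ X i - X j ∣ q := by
  intro hd
  obtain ⟨u, rfl⟩ := vandX_dvd fun k l hkl => X_sub_X_dvd_of_isSymmetric_sq hsym hij hd hkl
  have hu : (u ^ 2).IsSymmetric :=
    isSymmetric_of_mul_right (isSymmetric_vandX_sq hn) (pow_ne_zero 2 vandX_ne_zero)
      (by rwa [← mul_pow, mul_comm])
  obtain ⟨t, ht⟩ := exists_conjDiag_eq_of_isSymmetric hu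
  have h1 : symDisc n d = t * matDisc n ^ (k + 1) := by
    apply eq_of_forall_conjDiag_eq hn
    intro S
    rw [conjDiag_symDisc hn S e, map_mul, map_pow, conjDiag_matDisc hn, ht, ← hq]
    ring
  have h2 : s = t * matDisc n := by
    apply mul_right_cancel₀ (pow_ne_zero k (matDisc_ne_zero hn))
    rw [← hk, h1]; ring
  obtain ⟨c, hc, hΔ⟩ := exists_C_eq_of_totalDegree_le (hs.ne_zero hn) h2 (hs.2 _ _ h1)
  -- Two distinct indices exist, so `V` vanishes at 0 and the constant would be 0.
  have h3 := congrArg (eval 0) (conjDiag_matDisc hn 1)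
  rw [hΔ, map_pow, eval_zero_vandX hij] at h3
  simp [conjDiag] at h3
  exact hc h3

theorem isSymmetric_sq_of_mul_eq (hn : 1 ≤ n) {k : ℕ} {e : Fin (formDim n d) ≃ DegMonomial n d}
    {q : MvPolynomial (Fin n) ℂ} (hq : q ^ 2 * (vandX n ^ 2) ^ k = vandMon e ^ 2) :
    (q ^ 2).IsSymmetric := by
  refine isSymmetric_of_mul_right (q := (vandX n ^ 2) ^ k) (fun σ => ?_)
    (pow_ne_zero _ (pow_ne_zero _ vandX_ne_zero)) (by rw [hq]; exact isSymmetric_vandMon_sq hn e)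
  rw [map_pow, isSymmetric_vandX_sq hn σ]

theorem IsDiscSat.exists_eq_sq (hn : 1 ≤ n) {s : MatPoly n} (hs : IsDiscSat n d s) :
    ∃ r, s = r ^ 2 := by
  obtain ⟨e⟩ := nonempty_enumeration n d hn
  obtain ⟨k, hk⟩ := hs.1
  have h1 : ∀ S, conjDiag S s * (vandX n ^ 2) ^ k = vandMon e ^ 2 := fun S => by
    rw [← conjDiag_symDisc hn S e, hk, map_mul, map_pow, conjDiag_matDisc hn]
  have h2 : vandX n ^ k ∣ vandMon e := by
    rw [← UniqueFactorizationMonoid.pow_dvd_pow_iff_dvd two_ne_zero, ← h1 1, ← pow_mul, ← pow_mul,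
      mul_comm k]
    exact dvd_mul_left _ _
  obtain ⟨q, hq⟩ := h2
  have hq2 : q ^ 2 * (vandX n ^ 2) ^ k = vandMon e ^ 2 := by
    rw [hq]; ring
  have hsym := isSymmetric_sq_of_mul_eq hn hq2
  have hqs : q.IsSymmetric := isSymmetric_of_rename_swap fun i j hij =>
    (rename_eq_or_eq_neg hsym _).resolve_right fun h =>
      hs.not_X_sub_X_dvd hn hk e hq2 hsym hij (X_sub_X_dvd_of_rename_swap h)
  obtain ⟨r, hr⟩ := exists_conjDiag_eq_of_isSymmetric hqs
  refine ⟨r, eq_of_forall_conjDiag_eq hn fun S => ?_⟩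
  rw [map_pow, hr]
  exact mul_right_cancel₀ (pow_ne_zero k (pow_ne_zero 2 vandX_ne_zero))
    ((h1 S).trans hq2.symm)

/-- With `ρ_d(A) = U D W`, row `i` of the Kalman matrix is `(C_f U) D^i W`. Since `D` is diagonal
with the monomials as entries, a transposed Vandermonde matrix splits off on the left. -/
theorem vandMon_dvd_conjDiag_det (e : Fin (formDim n d) ≃ DegMonomial n d)
    (f : MvPolynomial (Fin n) ℂ) (S : (Matrix (Fin n) (Fin n) ℂ)ˣ) :
    vandMon e ∣ conjDiag S (kalmanMatrix e f).det := by
  set U := symPower d (S.1.map (C : ℂ →+* MvPolynomial (Fin n) ℂ)) with hU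
  set W := symPower d ((S⁻¹).1.map (C : ℂ →+* MvPolynomial (Fin n) ℂ)) with hW
  have hWU : W * U = 1 := symPower_map_C_inv_mul S
  have hUW : U * W = 1 := mul_eq_one_comm.mp hWU
  set m : DegMonomial n d → MvPolynomial (Fin n) ℂ := fun α => monomial α.1 1 with hm
  have hpow : ∀ i : ℕ, (U * Matrix.diagonal m * W) ^ i = U * Matrix.diagonal (m ^ i) * W := by
    intro i
    induction i with
    | zero => simp [hUW]
    | succ i ih =>
      have h1 : Matrix.diagonal (m ^ i * m) = Matrix.diagonal (m ^ i) * Matrix.diagonal m :=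
        (Matrix.diagonal_mul_diagonal _ _).symm
      rw [pow_succ, ih, pow_succ m, h1]
      calc _ = U * Matrix.diagonal (m ^ i) * (W * U) * Matrix.diagonal m * W := by
            simp only [mul_assoc]
        _ = _ := by rw [hWU, mul_one]; simp only [mul_assoc]
  let ψ : MatPoly n →+* MvPolynomial (Fin n) ℂ := conjDiag S
  let c : DegMonomial n d → MvPolynomial (Fin n) ℂ := fun β => C (coeff β.1 f)
  have hK : (kalmanMatrix e f).map ψ =
      (Matrix.vandermonde fun i => m (e i)).transpose *
        Matrix.of fun i j => Matrix.vecMul c U (e i) * W (e i) (e j) := by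
    ext1 i j
    have h1 : ψ (Matrix.vecMul (coeffRow d f) (symPower d (genMat n) ^ (i : ℕ)) (e j)) =
        Matrix.vecMul c (U * Matrix.diagonal (m ^ (i : ℕ)) * W) (e j) := by
      have hc : ψ ∘ coeffRow d f = c := by
        ext1 β
        simp [coeffRow, ψ, c, conjDiag]
      rw [RingHom.map_vecMul, Matrix.map_pow, symPower_map_conjDiag, hpow, hc]
    rw [Matrix.map_apply, kalmanMatrix, Matrix.of_apply, h1, ← Matrix.vecMul_vecMul,
      ← Matrix.vecMul_vecMul, Matrix.mul_apply]
    simp only [Matrix.vecMul, dotProduct]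
    rw [← Equiv.sum_comp e]
    refine Finset.sum_congr rfl fun a _ => ?_
    simp [Matrix.vandermonde_apply, Matrix.diagonal_apply]
    ring
  have h2 : conjDiag S (kalmanMatrix e f).det = ((kalmanMatrix e f).map ψ).det :=
    RingHom.map_det ψ _
  rw [h2, hK, Matrix.det_mul, Matrix.det_transpose]
  exact dvd_mul_right _ _

theorem IsDiscSat.dvd_det (hn : 1 ≤ n) {r : MatPoly n} (hs : IsDiscSat n d (r ^ 2))
    (e : Fin (formDim n d) ≃ DegMonomial n d) (f : MvPolynomial (Fin n) ℂ) :
    r ∣ (kalmanMatrix e f).det := by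
  obtain ⟨k, hk⟩ := hs.1
  have hr0 : r ≠ 0 := ne_zero_pow two_ne_zero (hs.ne_zero hn)
  have hr : ∀ S, conjDiag S r ^ 2 * (vandX n ^ 2) ^ k = vandMon e ^ 2 := fun S => by
    rw [← conjDiag_symDisc hn S e, hk, map_mul, map_pow, map_pow, conjDiag_matDisc hn]
  have hrS0 : ∀ S, conjDiag S r ≠ 0 := fun S h => by
    have := hr S
    rw [h, sq, zero_mul, zero_mul] at this
    exact pow_ne_zero 2 (vandMon_ne_zero e) this.symm
  have hdvd : ∀ S, conjDiag S r ∣ conjDiag S (kalmanMatrix e f).det := fun S => by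
    refine dvd_trans ?_ (vandMon_dvd_conjDiag_det e f S)
    rw [← UniqueFactorizationMonoid.pow_dvd_pow_iff_dvd two_ne_zero, ← hr S]
    exact dvd_mul_right _ _
  -- Cancel common factors: `r = g b`, `det K_d(f) = g a` with `a`, `b` coprime. It remains to show
  -- that `b` is a unit.
  obtain ⟨b, a, g, hrel, hb, ha⟩ :=
    UniqueFactorizationMonoid.exists_reduced_factors r hr0 (kalmanMatrix e f).det
  have hab : ∀ S, conjDiag S b ∣ conjDiag S a := fun S => by
    have h1 := hdvd S
    have h2 := hrS0 S
    rw [← hb, map_mul] at h2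
    rw [← hb, ← ha, map_mul, map_mul] at h1
    exact (mul_dvd_mul_iff_left (left_ne_zero_of_mul h2)).mp h1
  -- Nullstellensatz: at a zero of `b`, either `Δ = 0` or the matrix is diagonalizable and `a`
  -- vanishes because `conjDiag S b ∣ conjDiag S a`.
  have hrad : a * matDisc n ∈ (Ideal.span {b}).radical := by
    rw [← vanishingIdeal_zeroLocus_eq_radical (K := ℂ)]
    intro x hx
    have hbx : eval x b = 0 := hx b (Ideal.mem_span_singleton_self b)
    change eval x (a * matDisc n) = 0
    by_cases hΔ : eval x (matDisc n) = 0
    · rw [map_mul, hΔ, mul_zero]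
    · obtain ⟨S, μ, hS⟩ := exists_conjDiag_of_eval_matDisc_ne_zero hn hΔ
      obtain ⟨h, hh⟩ := hab S
      rw [map_mul, hS a, hh, map_mul, ← hS b, hbx, zero_mul, zero_mul]
  obtain ⟨M, hM⟩ := hrad
  rw [Ideal.mem_span_singleton, mul_pow] at hM
  have hbΔ : b ∣ matDisc n ^ M := hrel.pow_right.dvd_of_dvd_mul_left hM
  -- The image of `b` divides both the image of `r` and a power of `V`, which are coprime.
  have hunit : ∀ S, IsUnit (conjDiag S b) := fun S => by
    have h1 : IsRelPrime (conjDiag S r) ((vandX n ^ 2) ^ M) :=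
      (isRelPrime_vandX fun i j hij => hs.not_X_sub_X_dvd hn hk e (hr S)
        (isSymmetric_sq_of_mul_eq hn (hr S)) hij).pow_right.pow_right
    refine h1 (map_dvd _ ⟨g, by rw [← hb, mul_comm]⟩) ?_
    rw [← conjDiag_matDisc hn S, ← map_pow]
    exact map_dvd _ hbΔ
  -- Each image is a constant; at `x = 0` the matrix `S diag(x) S⁻¹` is 0, so this constant is `eval
  -- 0 b` for every `S`.
  have hconst : b = C (eval 0 b) := by
    refine eq_of_forall_conjDiag_eq hn fun S => ?_
    obtain ⟨c, -, hc⟩ := (isUnit_iff_eq_C_of_isReduced).mp (hunit S)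
    have h1 := eval_conjDiag S 0 b
    rw [hc, eval_C] at h1
    have h2 : (fun q : Fin n × Fin n =>
        (S.1 * Matrix.diagonal (0 : Fin n → ℂ) * (S⁻¹).1) q.1 q.2) = 0 := by
      ext q
      simp
    rw [h2] at h1
    rw [hc, h1]
    simp [conjDiag]
  have hbu : IsUnit b := by
    have h1 := hunit 1
    rw [hconst] at h1 ⊢
    have h2 : conjDiag (n := n) 1 (C (eval 0 b)) = C (eval 0 b) := by simp [conjDiag]
    rw [h2] at h1
    rw [isUnit_iff_eq_C_of_isReduced] at h1 ⊢
    obtain ⟨c, hc, h3⟩ := h1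
    exact ⟨c, hc, congrArg C (C_injective _ _ h3)⟩
  rw [← hb, ← ha]
  exact mul_dvd_mul_left g (hbu.dvd)

end Saturation

end Kalman

theorem mainTheorem6 (n d : ℕ) (hn : 1 ≤ n) (hd : 1 ≤ d) :
    (∃ s : Kalman.MatPoly n, Kalman.IsDiscSat n d s) ∧
    (∀ s t : Kalman.MatPoly n, Kalman.IsDiscSat n d s → Kalman.IsDiscSat n d t →
      ∃ c : ℂ, c ≠ 0 ∧ t = MvPolynomial.C c * s) ∧
    ∀ s : Kalman.MatPoly n, Kalman.IsDiscSat n d s →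
      (∃ r : Kalman.MatPoly n, s = r ^ 2) ∧
      ∀ r : Kalman.MatPoly n, s = r ^ 2 →
        ∀ f : MvPolynomial (Fin n) ℂ, f.IsHomogeneous d →
          ∀ e : Fin (Kalman.formDim n d) ≃ Kalman.DegMonomial n d,
            r ∣ (Kalman.kalmanMatrix e f).det := by
  refine ⟨Kalman.exists_isDiscSat, fun s t hs ht => Kalman.isDiscSat_unique hn hs ht,
    fun s hs => ⟨hs.exists_eq_sq hn, ?_⟩⟩
  rintro r rfl f - e
  exact hs.dvd_det hn e f
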